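/- Let $E$ be a finite-dimensional real inner product space (for instance $\mathbb R^n$), let $\Phi\subset E$ be a (crystallographic) root system in its span (which may be a proper subspace of $E$, or $0$), let $W$ be its Weyl group, generated by the reflections in the roots, and let $\Lambda_a$ be the root lattice, the subgroup of $E$ generated by $\Phi$. Let $W^+=W\ltimes\Lambda_a$ be the affine Weyl group, acting on $E$. Fix a fundamental chamber of $W$, say the one containing a vector $\xi$ that lies on no root hyperplane, and let $$C=\Big\{x\in E:\ 0\le \tfrac{2\langle x,r\rangle}{|r|^2}\le 1\ \text{ for all } r\in\Phi \text{ with } \langle \xi,r\rangle>0\Big\}$$ be the corresponding closed fundamental chamber (alcove) of $W^+$. Let $\Lambda\subset E$ be a subweight lattice of $W$, that is, a discrete subgroup of $E$ containing $\Phi$ such that $2\langle\lambda,r\rangle/|r|^2\in\mathbb Z$ for all $\lambda\in\Lambda$, $r\in\Phi$. Put $\Lambda_0=\Lambda\cap\mathbb R\Lambda_a$, and for $v\in E$ and $L\in\{\Lambda_a,\Lambda\}$ put $$W^{v+L}=\{w\in W:\ w(v)-v\in L\}.$$ Theorem. Let $v\in E$ be any vector. Then $W^{v+\Lambda_a}$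 is a normal subgroup of $W^{v+\Lambda}$. The $W^+$-orbit of $v$ meets $C$ in exactly one point $\overline v$; for each class $q=\lambda+\Lambda_a\in\Lambda_0/\Lambda_a$ the coset $t_\lambda W^+$ of the translation $t_\lambda$ by $\lambda$ contains exactly one element $\psi_q$ with $\psi_q(C)=C$; the set $$\Gamma=\{q\in\Lambda_0/\Lambda_a:\ \psi_q(\overline v)=\overline v\}$$ is a subgroup of $\Lambda_0/\Lambda_a$; and $$W^{v+\Lambda}/W^{v+\Lambda_a}\;\cong\;\Gamma.$$ -/

import Mathlib

namespace WeylCongruence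

variable {E : Type*} [NormedAddCommGroup E] [InnerProductSpace ℝ E]

/-- The value `2⟨x, r⟩ / |r|²` of the coroot of `r` at `x`. -/
noncomputable def corootPairing (x r : E) : ℝ := 2 * inner ℝ x r / ‖r‖ ^ 2

/-- The orthogonal reflection of `E` in the hyperplane `r^⊥`. -/
noncomputable def rootReflection (r : E) : E ≃ₗᵢ[ℝ] E := (Submodule.span ℝ {r})ᗮ.reflection

/-- `Φ` is a (crystallographic) root system in its linear span, which may be smaller than the
Euclidean space `E`: a finite set of nonzero vectors, stable under the reflections in its
members, with integral Cartan numbers. -/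
structure IsRootSystem (Φ : Set E) : Prop where
  finite : Φ.Finite
  zero_notMem : (0 : E) ∉ Φ
  reflection_mem : ∀ r ∈ Φ, ∀ s ∈ Φ, rootReflection r s ∈ Φ
  integral : ∀ r ∈ Φ, ∀ s ∈ Φ, ∃ k : ℤ, corootPairing s r = k

/-- The Weyl group, generated by the reflections in the roots. -/
noncomputable def weylGroup (Φ : Set E) : Subgroup (E ≃ₗᵢ[ℝ] E) :=
  Subgroup.closure (rootReflection '' Φ)

/-- The root lattice `Λ_a`, generated by the roots. -/
def rootLattice (Φ : Set E) : AddSubgroup E := AddSubgroup.closure Φ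

/-- An additive subgroup `L` of `E` is subweight if it contains the roots and
`2⟨x, r⟩ / |r|²` is an integer for all `x ∈ L` and all roots `r`. -/
structure IsSubweight (Φ : Set E) (L : AddSubgroup E) : Prop where
  roots_subset : Φ ⊆ L
  integral : ∀ x ∈ L, ∀ r ∈ Φ, ∃ k : ℤ, corootPairing x r = k

theorem rootReflection_apply (r x : E) :
    rootReflection r x = x - corootPairing x r • r := by
  rw [rootReflection, Submodule.reflection_orthogonal_apply, Submodule.reflection_singleton_apply,
    corootPairing, real_inner_comm x r]
  simp only [RCLike.ofReal_real_eq_id, id_eq, neg_sub, two_smul, ← add_smul]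
  congr 2
  ring

/-- The root lattice is subweight. -/
theorem IsRootSystem.isSubweight_rootLattice {Φ : Set E} (hΦ : IsRootSystem Φ) :
    IsSubweight Φ (rootLattice Φ) where
  roots_subset := AddSubgroup.subset_closure
  integral := by
    intro x hx r hr
    induction hx using AddSubgroup.closure_induction with
    | mem s hs => exact hΦ.integral r hr s hs
    | zero => exact ⟨0, by simp [corootPairing]⟩
    | add a b _ _ ha hb =>
      obtain ⟨k, hk⟩ := ha
      obtain ⟨l, hl⟩ := hb
      refine ⟨k + l, ?_⟩
      rw [Int.cast_add, ← hk, ← hl]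
      simp only [corootPairing, inner_add_left]
      ring
    | neg a _ ha =>
      obtain ⟨k, hk⟩ := ha
      refine ⟨-k, ?_⟩
      rw [Int.cast_neg, ← hk]
      simp only [corootPairing, inner_neg_left]
      ring

/-- A subweight subgroup is stable under the Weyl group. -/
theorem IsSubweight.weylGroup_apply_mem {Φ : Set E} {L : AddSubgroup E} (hL : IsSubweight Φ L)
    {w : E ≃ₗᵢ[ℝ] E} (hw : w ∈ weylGroup Φ) : ∀ x ∈ L, w x ∈ L := by
  have hrefl : ∀ r ∈ Φ, ∀ x ∈ L, rootReflection r x ∈ L := by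
    intro r hr x hx
    obtain ⟨k, hk⟩ := hL.integral x hx r hr
    rw [rootReflection_apply, hk, Int.cast_smul_eq_zsmul]
    exact L.sub_mem hx (L.zsmul_mem (hL.roots_subset hr) k)
  induction hw using Subgroup.closure_induction'' with
  | one => exact fun x hx => hx
  | mem w hw =>
    obtain ⟨r, hr, rfl⟩ := hw
    exact hrefl r hr
  | inv_mem w hw =>
    obtain ⟨r, hr, rfl⟩ := hw
    have : (rootReflection r)⁻¹ = rootReflection r := Submodule.reflection_inv
    rw [this]
    exact hrefl r hr
  | mul a b _ _ ha hb => exact fun x hx => ha _ (hb x hx)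

/-- The congruential subgroup `W^{v+L} = {w ∈ W | w v - v ∈ L}` of the Weyl group `W`. -/
noncomputable def congruentialSubgroup (Φ : Set E) (L : AddSubgroup E) (hL : IsSubweight Φ L)
    (v : E) : Subgroup (E ≃ₗᵢ[ℝ] E) where
  carrier := {w | w ∈ weylGroup Φ ∧ w v - v ∈ L}
  one_mem' := ⟨one_mem _, by simp⟩
  mul_mem' := by
    rintro a b ⟨ha, ha'⟩ ⟨hb, hb'⟩
    refine ⟨mul_mem ha hb, ?_⟩
    have h := L.add_mem (hL.weylGroup_apply_mem ha _ hb') ha'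
    rw [map_sub, sub_add_sub_cancel] at h
    exact h
  inv_mem' := by
    rintro a ⟨ha, ha'⟩
    refine ⟨inv_mem ha, ?_⟩
    have h := L.neg_mem (hL.weylGroup_apply_mem (inv_mem ha) _ ha')
    have e : a⁻¹ (a v) = v := a.symm_apply_apply v
    rw [map_sub, e, neg_sub] at h
    exact h

/-- The translation `x ↦ l + x` of `E`. -/
noncomputable def translation (l : E) : E ≃ᵃⁱ[ℝ] E := AffineIsometryEquiv.constVAdd ℝ E l

/-- The affine Weyl group `W⁺ = W ⋉ Λ_a`, realized as the group of affine isometries of `E`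
generated by the Weyl group and the translations by the root lattice. -/
noncomputable def affineWeylGroup (Φ : Set E) : Subgroup (E ≃ᵃⁱ[ℝ] E) :=
  Subgroup.closure (LinearIsometryEquiv.toAffineIsometryEquiv '' (weylGroup Φ : Set (E ≃ₗᵢ[ℝ] E)) ∪
    translation '' (rootLattice Φ : Set E))

/-- A vector is regular if it lies on no root hyperplane. A regular vector `ξ` fixes a fundamental
chamber of `W`, the one containing `ξ`; the positive roots are then those with `0 < ⟨ξ, r⟩`. -/
def IsRegular (Φ : Set E) (ξ : E) : Prop := ∀ r ∈ Φ, inner ℝ ξ r ≠ 0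

/-- The (closed) fundamental chamber of the affine Weyl group `W⁺`, that is the closed alcove at the
origin inside the fundamental chamber of `W` containing the regular vector `ξ`. (The reflection
hyperplanes of `W⁺` are the sets `2⟨x, r⟩ / |r|² = k`, with `r` a root and `k` an integer.) -/
def fundamentalAlcove (Φ : Set E) (ξ : E) : Set E :=
  {x | ∀ r ∈ Φ, 0 < inner ℝ ξ r → 0 ≤ corootPairing x r ∧ corootPairing x r ≤ 1}

/-- `y` is a point of the `W⁺`-orbit of `v` in the fundamental chamber of `W⁺`. -/
def IsNormalizedPoint (Φ : Set E) (ξ v y : E) : Prop :=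
  y ∈ fundamentalAlcove Φ ξ ∧ ∃ ρ ∈ affineWeylGroup Φ, ρ v = y

/-- `ψ` is an element of the coset `t_l W⁺` of the translation `t_l` that preserves the
fundamental chamber of `W⁺`. -/
def IsAlcoveTransformation (Φ : Set E) (ξ l : E) (ψ : E ≃ᵃⁱ[ℝ] E) : Prop :=
  (translation l)⁻¹ * ψ ∈ affineWeylGroup Φ ∧ ψ '' fundamentalAlcove Φ ξ = fundamentalAlcove Φ ξ

/-- `Λ_0 = Λ ∩ ℝΛ_a`. -/
def rootSpacePart (Φ : Set E) (L : AddSubgroup E) : AddSubgroup E :=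
  L ⊓ (Submodule.span ℝ (rootLattice Φ : Set E)).toAddSubgroup

/-- The quotient group `Λ_0 / Λ_a` (`Λ_a` is contained in `Λ_0` when `Λ` is subweight). -/
abbrev RootQuotient (Φ : Set E) (L : AddSubgroup E) : Type _ :=
  rootSpacePart Φ L ⧸ (rootLattice Φ).addSubgroupOf (rootSpacePart Φ L)

end WeylCongruence

namespace WeylCongruence

variable {E : Type*} [NormedAddCommGroup E] [InnerProductSpace ℝ E]

/-! ### Affine roots and their reflections -/

/-! Subweight means that `W` acts trivially on `Λ/Λ_a` (`IsSubweight.apply_sub_mem_rootLattice`).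
Hence `w ↦ w v - v` modulo `Λ_a` is a homomorphism on `W^{v+Λ}` (`displacementHom`) with kernel
`W^{v+Λ_a}`, and the first isomorphism theorem leaves only its range to identify. The class of `l`
is attained exactly when `l + v` lies in the `W⁺`-orbit of `v`. Translation by `l` normalizes `W⁺`,
so `ψ_l` carries the orbit of `v` to that of `l + v`; since `C` meets each orbit once, the two
orbits agree exactly when `ψ_l` fixes the normalized point
(`IsBasePoint.alcoveTransformation_fix_iff`).

The geometric input is that `C` is a strict fundamental domain and that `W⁺` acts freely on alcoves.
Everything is measured from a point `p` inside `C`. Reflecting a point in a hyperplane that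
separates it from `p` brings it closer to `p`, so distance minimizers land in `C`. A wall is a
hyperplane such that no other one separates `p` from its mirror image. A minimal defining set of
inequalities supplies enough walls (`IsBasePoint.exists_wallRoot`), their reflections generate `W⁺`,
and the exchange property shrinks any word that keeps `p` in its open alcove to the empty word. -/

theorem corootPairing_add (x y r : E) :
    corootPairing (x + y) r = corootPairing x r + corootPairing y r := by
  simp only [corootPairing, inner_add_left]
  ring

theorem corootPairing_smul (c : ℝ) (x r : E) :
    corootPairing (c • x) r = c * corootPairing x r := by
  simp only [corootPairing, real_inner_smul_left]
  ring

theorem corootPairing_neg_right (x r : E) : corootPairing x (-r) = -corootPairing x r := by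
  simp only [corootPairing, inner_neg_right, norm_neg]
  ring

theorem corootPairing_neg_left (x r : E) : corootPairing (-x) r = -corootPairing x r := by
  simp only [corootPairing, inner_neg_left]
  ring

theorem corootPairing_sub (x y r : E) :
    corootPairing (x - y) r = corootPairing x r - corootPairing y r := by
  rw [sub_eq_add_neg, corootPairing_add, corootPairing_neg_left, sub_eq_add_neg]

theorem corootPairing_self {r : E} (hr : r ≠ 0) : corootPairing r r = 2 := by
  have : ‖r‖ ≠ 0 := norm_ne_zero_iff.mpr hr
  rw [corootPairing, real_inner_self_eq_norm_sq]
  field_simp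

theorem corootPairing_map (w : E ≃ₗᵢ[ℝ] E) (x r : E) :
    corootPairing (w x) (w r) = corootPairing x r := by
  simp [corootPairing]

theorem continuous_corootPairing (r : E) : Continuous fun x : E => corootPairing x r := by
  unfold corootPairing
  fun_prop

/-- The affine function `x ↦ 2⟨x, r⟩ / |r|² - k` attached to a pair `a = (r, k)`. -/
noncomputable def level (a : E × ℤ) (x : E) : ℝ := corootPairing x a.1 - a.2

/-- The affine reflection in the zero set of `level a`. -/
noncomputable def affineReflection (a : E × ℤ) : E ≃ᵃⁱ[ℝ] E :=
  translation ((a.2 : ℝ) • a.1) * (rootReflection a.1).toAffineIsometryEquiv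

theorem translation_apply (l x : E) : translation l x = l + x := rfl

theorem translation_inv (l : E) : (translation l)⁻¹ = translation (-l) := by
  refine inv_eq_of_mul_eq_one_right ?_
  ext x
  change l + (-l + x) = x
  abel

theorem translation_mul (l m : E) : translation l * translation m = translation (l + m) := by
  ext x
  change l + (m + x) = l + m + x
  abel

theorem affineReflection_apply (a : E × ℤ) (x : E) :
    affineReflection a x = x - level a x • a.1 := by
  change (a.2 : ℝ) • a.1 + rootReflection a.1 x = _
  rw [rootReflection_apply, level, sub_smul]
  abel

theorem continuous_level (a : E × ℤ) : Continuous (level a) :=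
  (continuous_corootPairing a.1).sub continuous_const

theorem level_add_smul (a : E × ℤ) (x d : E) (c : ℝ) :
    level a (x + c • d) = level a x + c * corootPairing d a.1 := by
  simp only [level, corootPairing_add, corootPairing_smul]
  ring

theorem level_lineMap (a : E × ℤ) (x y : E) (c : ℝ) :
    level a (x + c • (y - x)) = (1 - c) * level a x + c * level a y := by
  rw [level_add_smul, corootPairing_sub, level, level]
  ring

theorem level_affineReflection (a b : E × ℤ) (x : E) :
    level a (affineReflection b x) = level a x - level b x * corootPairing b.1 a.1 := by
  rw [affineReflection_apply, sub_eq_add_neg, ← neg_smul, level_add_smul]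
  ring

theorem level_neg (a : E × ℤ) (x : E) : level (-a) x = -level a x := by
  simp only [level, Prod.fst_neg, Prod.snd_neg, corootPairing_neg_right, Int.cast_neg]
  ring

theorem affineReflection_neg (a : E × ℤ) : affineReflection (-a) = affineReflection a := by
  ext x
  rw [affineReflection_apply, affineReflection_apply, level_neg, Prod.fst_neg, smul_neg, neg_smul,
    neg_neg]

theorem level_affineReflection_self {a : E × ℤ} (ha : a.1 ≠ 0) (x : E) :
    level a (affineReflection a x) = -level a x := by
  rw [level_affineReflection, corootPairing_self ha]
  ring

theorem affineReflection_mul_self {a : E × ℤ} (ha : a.1 ≠ 0) :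
    affineReflection a * affineReflection a = 1 := by
  ext x
  change affineReflection a (affineReflection a x) = x
  rw [affineReflection_apply a (affineReflection a x), level_affineReflection_self ha,
    affineReflection_apply, neg_smul]
  abel

theorem affineReflection_inv {a : E × ℤ} (ha : a.1 ≠ 0) :
    (affineReflection a)⁻¹ = affineReflection a :=
  inv_eq_of_mul_eq_one_left (affineReflection_mul_self ha)

theorem affineReflection_affineReflection {a : E × ℤ} (ha : a.1 ≠ 0) (x : E) :
    affineReflection a (affineReflection a x) = x :=
  DFunLike.congr_fun (affineReflection_mul_self ha) x

theorem affineReflection_eq_self {a : E × ℤ} {x : E} (h : level a x = 0) :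
    affineReflection a x = x := by
  rw [affineReflection_apply, h, zero_smul, sub_zero]

theorem dist_affineReflection (a : E × ℤ) (x : E) :
    dist (affineReflection a x) x = |level a x| * ‖a.1‖ := by
  rw [affineReflection_apply, dist_eq_norm, sub_sub_cancel_left, norm_neg, norm_smul,
    Real.norm_eq_abs]

/-- Reflecting in a hyperplane that separates `x` from `p` moves `x` closer to `p`. -/
theorem dist_affineReflection_lt {a : E × ℤ} (ha : a.1 ≠ 0) {x p : E} (hx : level a x < 0)
    (hp : 0 < level a p) : dist (affineReflection a x) p < dist x p := by
  have hn : 0 < ‖a.1‖ := norm_pos_iff.mpr ha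
  have hin : inner ℝ (x - p) a.1 = (level a x - level a p) * ‖a.1‖ ^ 2 / 2 := by
    have : corootPairing (x - p) a.1 = level a x - level a p := by
      rw [corootPairing_sub, level, level]
      ring
    rw [← this, corootPairing]
    field_simp
  rw [dist_eq_norm, dist_eq_norm]
  refine lt_of_pow_lt_pow_left₀ 2 (norm_nonneg _) ?_
  rw [affineReflection_apply, sub_right_comm, norm_sub_sq_real, real_inner_smul_right, hin,
    norm_smul, mul_pow, Real.norm_eq_abs, sq_abs]
  -- The squared distance changes by exactly `level a x * level a p * ‖a.1‖ ^ 2`.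
  have := mul_pos (mul_pos_of_neg_of_neg hx (neg_neg_of_pos hp)) (pow_pos hn 2)
  nlinarith

/-- Two affine reflections with proportional roots and a common fixed point agree. -/
theorem affineReflection_eq_of_smul {a b : E × ℤ} (ha : a.1 ≠ 0) {c : ℝ} (hb : b.1 ≠ 0)
    (hab : b.1 = c • a.1) {z : E} (hza : level a z = 0) (hzb : level b z = 0) :
    affineReflection b = affineReflection a := by
  have hc : c ≠ 0 := by
    rintro rfl
    exact hb (by rw [hab, zero_smul])
  have hn : ‖a.1‖ ≠ 0 := norm_ne_zero_iff.mpr ha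
  -- Measured from the common zero `z`, both levels are linear; scaling a root by `c` scales its
  -- coroot by `c⁻¹`.
  have key : ∀ x, level b x = c⁻¹ * level a x := by
    intro x
    have h1 : level b x = corootPairing (x - z) b.1 := by
      rw [corootPairing_sub, ← sub_zero (level b x), ← hzb, level, level]
      ring
    have h2 : level a x = corootPairing (x - z) a.1 := by
      rw [corootPairing_sub, ← sub_zero (level a x), ← hza, level, level]
      ring
    rw [h1, h2, hab, corootPairing, corootPairing, real_inner_smul_right, norm_smul, mul_pow,
      Real.norm_eq_abs, sq_abs]
    field_simp
  ext x
  rw [affineReflection_apply, affineReflection_apply, key, hab, smul_smul]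
  congr 2
  field_simp

/-! ### The affine Weyl group -/

theorem IsRootSystem.ne_zero {Φ : Set E} (hΦ : IsRootSystem Φ) {r : E} (hr : r ∈ Φ) : r ≠ 0 :=
  fun h => hΦ.zero_notMem (h ▸ hr)

theorem IsRootSystem.neg_mem {Φ : Set E} (hΦ : IsRootSystem Φ) {r : E} (hr : r ∈ Φ) : -r ∈ Φ := by
  have h := hΦ.reflection_mem r hr r hr
  rw [rootReflection_apply, corootPairing_self (hΦ.ne_zero hr)] at h
  convert h using 1
  rw [two_smul]
  abel

theorem rootReflection_mem_weylGroup {Φ : Set E} {r : E} (hr : r ∈ Φ) :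
    rootReflection r ∈ weylGroup Φ :=
  Subgroup.subset_closure ⟨r, hr, rfl⟩

theorem IsRootSystem.weylGroup_apply_mem {Φ : Set E} (hΦ : IsRootSystem Φ) {w : E ≃ₗᵢ[ℝ] E}
    (hw : w ∈ weylGroup Φ) : ∀ r ∈ Φ, w r ∈ Φ := by
  induction hw using Subgroup.closure_induction'' with
  | one => exact fun x hx => hx
  | mem w hw =>
    obtain ⟨r, hr, rfl⟩ := hw
    exact hΦ.reflection_mem r hr
  | inv_mem w hw =>
    obtain ⟨r, hr, rfl⟩ := hw
    have : (rootReflection r)⁻¹ = rootReflection r := Submodule.reflection_inv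
    rw [this]
    exact hΦ.reflection_mem r hr
  | mul a b _ _ ha hb => exact fun x hx => ha _ (hb x hx)

/-- The Weyl group moves vectors of a subweight subgroup within their class modulo the root
lattice. -/
theorem IsSubweight.apply_sub_mem_rootLattice {Φ : Set E} {L : AddSubgroup E}
    (hL : IsSubweight Φ L) {w : E ≃ₗᵢ[ℝ] E} (hw : w ∈ weylGroup Φ) :
    ∀ x ∈ L, w x - x ∈ rootLattice Φ := by
  have hrefl : ∀ r ∈ Φ, ∀ x ∈ L, rootReflection r x - x ∈ rootLattice Φ := by
    intro r hr x hx
    obtain ⟨k, hk⟩ := hL.integral x hx r hr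
    rw [rootReflection_apply, hk, Int.cast_smul_eq_zsmul, sub_sub_cancel_left]
    exact neg_mem (zsmul_mem (AddSubgroup.subset_closure hr) k)
  induction hw using Subgroup.closure_induction'' with
  | one => simp
  | mem w hw =>
    obtain ⟨r, hr, rfl⟩ := hw
    exact hrefl r hr
  | inv_mem w hw =>
    obtain ⟨r, hr, rfl⟩ := hw
    have : (rootReflection r)⁻¹ = rootReflection r := Submodule.reflection_inv
    rw [this]
    exact hrefl r hr
  | mul a b _ hb' ha hb =>
    intro x hx
    have h := add_mem (ha _ (hL.weylGroup_apply_mem hb' x hx)) (hb x hx)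
    rwa [sub_add_sub_cancel] at h

/-- Since `Φ` need not span `E`, this is what places displacements in `Λ_0` rather than merely in
`Λ`. -/
theorem weylGroup_apply_sub_mem_span {Φ : Set E} {w : E ≃ₗᵢ[ℝ] E} (hw : w ∈ weylGroup Φ) :
    ∀ x, w x - x ∈ Submodule.span ℝ Φ := by
  have hrefl : ∀ r ∈ Φ, ∀ x, rootReflection r x - x ∈ Submodule.span ℝ Φ := by
    intro r hr x
    rw [rootReflection_apply, sub_sub_cancel_left]
    exact neg_mem (Submodule.smul_mem _ _ (Submodule.subset_span hr))
  induction hw using Subgroup.closure_induction'' with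
  | one => simp
  | mem w hw =>
    obtain ⟨r, hr, rfl⟩ := hw
    exact hrefl r hr
  | inv_mem w hw =>
    obtain ⟨r, hr, rfl⟩ := hw
    have : (rootReflection r)⁻¹ = rootReflection r := Submodule.reflection_inv
    rw [this]
    exact hrefl r hr
  | mul a b _ _ ha hb =>
    intro x
    have h := add_mem (ha (b x)) (hb x)
    rwa [sub_add_sub_cancel] at h

/-- An isometry in `W` fixing every root is the identity. -/
theorem eq_one_of_mem_weylGroup {Φ : Set E} {w : E ≃ₗᵢ[ℝ] E} (hw : w ∈ weylGroup Φ)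
    (h : ∀ r ∈ Φ, w r = r) : w = 1 := by
  ext x
  have hspan : ∀ y ∈ Submodule.span ℝ Φ, w y = y := by
    intro y hy
    induction hy using Submodule.span_induction with
    | mem r hr => exact h r hr
    | zero => exact map_zero w
    | add a b _ _ ha hb => rw [map_add, ha, hb]
    | smul c a _ ha => rw [map_smul, ha]
  have hd := weylGroup_apply_sub_mem_span hw x
  -- The displacement `d = w x - x` lies in the span, so `w` fixes it and `⟨w x, d⟩ = ⟨w x, w d⟩ =
  -- ⟨x, d⟩`.
  have h0 : inner ℝ (w x - x) (w x - x) = (0 : ℝ) := by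
    have e := w.inner_map_map x (w x - x)
    rw [hspan _ hd] at e
    rw [inner_sub_left, e, sub_self]
  exact sub_eq_zero.mp (inner_self_eq_zero.mp h0)

/-- The action on the finite set `Φ` is faithful, even when `Φ` does not span `E`. -/
theorem IsRootSystem.finite_weylGroup {Φ : Set E} (hΦ : IsRootSystem Φ) :
    (weylGroup Φ : Set (E ≃ₗᵢ[ℝ] E)).Finite := by
  have : Finite Φ := hΦ.finite
  let f : weylGroup Φ → (Φ → Φ) := fun w r => ⟨w.1 r, hΦ.weylGroup_apply_mem w.2 r r.2⟩
  have hf : Function.Injective f := by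
    intro a b hab
    have hab' : ∀ r ∈ Φ, a.1 r = b.1 r := fun r hr =>
      congrArg Subtype.val (congrFun hab ⟨r, hr⟩)
    have : (b⁻¹ * a).1 = 1 := by
      refine eq_one_of_mem_weylGroup (b⁻¹ * a).2 fun r hr => ?_
      change b.1.symm (a.1 r) = r
      rw [hab' r hr]
      exact b.1.symm_apply_apply r
    have h1 : b⁻¹ * a = 1 := Subtype.ext this
    exact (inv_mul_eq_one.mp h1).symm
  have : Finite (weylGroup Φ) := Finite.of_injective f hf
  exact Set.toFinite _

/-- `ρ` is an element of `W ⋉ L`, acting on `E`. -/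
def IsExtended (Φ : Set E) (L : AddSubgroup E) (ρ : E ≃ᵃⁱ[ℝ] E) : Prop :=
  ∃ w ∈ weylGroup Φ, ∃ l ∈ L, ∀ x, ρ x = w x + l

theorem IsExtended.mono {Φ : Set E} {L M : AddSubgroup E} (h : L ≤ M) {ρ : E ≃ᵃⁱ[ℝ] E}
    (hρ : IsExtended Φ L ρ) : IsExtended Φ M ρ := by
  obtain ⟨w, hw, l, hl, hρ⟩ := hρ
  exact ⟨w, hw, l, h hl, hρ⟩

theorem IsExtended.mul {Φ : Set E} {L : AddSubgroup E} (hL : IsSubweight Φ L)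
    {ρ σ : E ≃ᵃⁱ[ℝ] E} (hρ : IsExtended Φ L ρ) (hσ : IsExtended Φ L σ) :
    IsExtended Φ L (ρ * σ) := by
  obtain ⟨w, hw, l, hl, hρ⟩ := hρ
  obtain ⟨u, hu, m, hm, hσ⟩ := hσ
  refine ⟨w * u, mul_mem hw hu, w m + l, add_mem (hL.weylGroup_apply_mem hw m hm) hl, fun x => ?_⟩
  change ρ (σ x) = w (u x) + _
  rw [hσ, hρ, map_add, add_assoc]

theorem IsExtended.inv {Φ : Set E} {L : AddSubgroup E} (hL : IsSubweight Φ L)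
    {ρ : E ≃ᵃⁱ[ℝ] E} (hρ : IsExtended Φ L ρ) : IsExtended Φ L ρ⁻¹ := by
  obtain ⟨w, hw, l, hl, hρ⟩ := hρ
  refine ⟨w⁻¹, inv_mem hw, -w⁻¹ l, neg_mem (hL.weylGroup_apply_mem (inv_mem hw) l hl),
    fun x => ?_⟩
  apply ρ.injective
  change ρ (ρ.symm x) = _
  rw [ρ.apply_symm_apply, hρ, map_add, map_neg]
  change x = w (w.symm x) + -w (w.symm l) + l
  rw [w.apply_symm_apply, w.apply_symm_apply]
  abel

/-- Normal form: `W` preserves `Λ_a`, so the maps `x ↦ w x + l` are already closed under products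
and inverses. -/
theorem IsRootSystem.mem_affineWeylGroup_iff {Φ : Set E} (hΦ : IsRootSystem Φ)
    {ρ : E ≃ᵃⁱ[ℝ] E} : ρ ∈ affineWeylGroup Φ ↔ IsExtended Φ (rootLattice Φ) ρ := by
  constructor
  · intro h
    induction h using Subgroup.closure_induction with
    | mem ρ h =>
      rcases h with ⟨w, hw, rfl⟩ | ⟨l, hl, rfl⟩
      · exact ⟨w, hw, 0, zero_mem _, fun x => (add_zero _).symm⟩
      · exact ⟨1, one_mem _, l, hl, fun x => add_comm _ _⟩
    | one => exact ⟨1, one_mem _, 0, zero_mem _, fun x => (add_zero _).symm⟩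
    | mul a b _ _ ha hb => exact ha.mul hΦ.isSubweight_rootLattice hb
    | inv a _ ha => exact ha.inv hΦ.isSubweight_rootLattice
  · rintro ⟨w, hw, l, hl, hρ⟩
    have : ρ = translation l * w.toAffineIsometryEquiv := by
      ext x
      rw [hρ, add_comm]
      rfl
    rw [this]
    exact mul_mem (Subgroup.subset_closure (Or.inr ⟨l, hl, rfl⟩))
      (Subgroup.subset_closure (Or.inl ⟨w, hw, rfl⟩))

theorem isExtended_translation {Φ : Set E} {L : AddSubgroup E} {l : E} (hl : l ∈ L) :
    IsExtended Φ L (translation l) :=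
  ⟨1, one_mem _, l, hl, fun _ => add_comm _ _⟩

theorem IsSubweight.rootLattice_le {Φ : Set E} {L : AddSubgroup E} (hL : IsSubweight Φ L) :
    rootLattice Φ ≤ L :=
  (AddSubgroup.closure_le L).mpr hL.roots_subset

theorem affineReflection_mem {Φ : Set E} {a : E × ℤ} (ha : a.1 ∈ Φ) :
    affineReflection a ∈ affineWeylGroup Φ := by
  refine mul_mem (Subgroup.subset_closure (Or.inr ⟨_, ?_, rfl⟩))
    (Subgroup.subset_closure (Or.inl ⟨_, rootReflection_mem_weylGroup ha, rfl⟩))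
  rw [Int.cast_smul_eq_zsmul]
  exact zsmul_mem (AddSubgroup.subset_closure ha) _

/-- Reflections in parallel hyperplanes compose to a translation; this puts `Λ_a` in the group
generated by affine reflections. -/
theorem translation_eq_mul_affineReflection {r : E} (hr : r ≠ 0) :
    translation r = affineReflection (r, 1) * affineReflection (r, 0) := by
  ext x
  change r + x = affineReflection (r, 1) (affineReflection (r, 0) x)
  rw [affineReflection_apply (r, 1), level_affineReflection, corootPairing_self hr,
    affineReflection_apply]
  simp only [level]
  module

/-- The affine Weyl group is generated by the affine reflections. -/
theorem IsRootSystem.affineWeylGroup_le {Φ : Set E} (hΦ : IsRootSystem Φ)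
    {H : Subgroup (E ≃ᵃⁱ[ℝ] E)} (hH : ∀ a : E × ℤ, a.1 ∈ Φ → affineReflection a ∈ H) :
    affineWeylGroup Φ ≤ H := by
  refine (Subgroup.closure_le H).mpr ?_
  rintro ρ (⟨w, hw, rfl⟩ | ⟨l, hl, rfl⟩)
  · replace hw : w ∈ weylGroup Φ := hw
    change w.toAffineIsometryEquiv ∈ H
    have hrefl : ∀ r ∈ Φ, (rootReflection r).toAffineIsometryEquiv ∈ H := by
      intro r hr
      convert hH (r, 0) hr using 1
      ext x
      rw [affineReflection_apply, level]
      simp [rootReflection_apply]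
    induction hw using Subgroup.closure_induction'' with
    | one => exact one_mem H
    | mem w hw =>
      obtain ⟨r, hr, rfl⟩ := hw
      exact hrefl r hr
    | inv_mem w hw =>
      obtain ⟨r, hr, rfl⟩ := hw
      have : (rootReflection r)⁻¹ = rootReflection r := Submodule.reflection_inv
      rw [this]
      exact hrefl r hr
    | mul a b _ _ ha hb => exact mul_mem ha hb
  · replace hl : l ∈ rootLattice Φ := hl
    change translation l ∈ H
    induction hl using AddSubgroup.closure_induction with
    | mem r hr =>
      rw [translation_eq_mul_affineReflection (hΦ.ne_zero hr)]
      exact mul_mem (hH _ hr) (hH _ hr)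
    | zero =>
      convert one_mem H
      ext x
      exact zero_add x
    | add a b _ _ ha hb =>
      rw [← translation_mul]
      exact mul_mem ha hb
    | neg a _ ha =>
      rw [← translation_inv]
      exact inv_mem ha

/-- Elements of `W ⋉ L` permute the affine roots. -/
theorem IsExtended.exists_level_comp {Φ : Set E} (hΦ : IsRootSystem Φ) {L : AddSubgroup E}
    (hL : IsSubweight Φ L) {ρ : E ≃ᵃⁱ[ℝ] E} (hρ : IsExtended Φ L ρ) {a : E × ℤ} (ha : a.1 ∈ Φ) :
    ∃ b : E × ℤ, b.1 ∈ Φ ∧ (∀ x, level a (ρ x) = level b x) ∧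
      affineReflection a * ρ = ρ * affineReflection b := by
  obtain ⟨w, hw, l, hl, hρ⟩ := hρ
  obtain ⟨k, hk⟩ := hL.integral l hl a.1 ha
  have hwi : ∀ y, w (w⁻¹ y) = y := fun y => w.apply_symm_apply y
  have hlev : ∀ x, level a (ρ x) = level (w⁻¹ a.1, a.2 - k) x := by
    intro x
    simp only [level]
    rw [hρ, corootPairing_add, hk, ← corootPairing_map w x, hwi]
    push_cast
    ring
  refine ⟨(w⁻¹ a.1, a.2 - k), hΦ.weylGroup_apply_mem (inv_mem hw) _ ha, hlev, ?_⟩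
  ext x
  change affineReflection a (ρ x) = ρ (affineReflection _ x)
  rw [affineReflection_apply, affineReflection_apply, hlev, hρ, hρ, map_sub, map_smul, hwi]
  abel

/-- Translations by a subweight subgroup normalize the affine Weyl group. -/
theorem IsSubweight.conj_translation_mem {Φ : Set E} (hΦ : IsRootSystem Φ) {L : AddSubgroup E}
    (hL : IsSubweight Φ L) {l : E} (hl : l ∈ L) {ρ : E ≃ᵃⁱ[ℝ] E} (hρ : ρ ∈ affineWeylGroup Φ) :
    (translation l)⁻¹ * ρ * translation l ∈ affineWeylGroup Φ := by
  rw [hΦ.mem_affineWeylGroup_iff] at hρ ⊢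
  obtain ⟨w, hw, m, hm, hρ⟩ := hρ
  refine ⟨w, hw, (w l - l) + m, add_mem (hL.apply_sub_mem_rootLattice hw l hl) hm, fun x => ?_⟩
  rw [translation_inv]
  change -l + ρ (l + x) = _
  rw [hρ, map_add]
  abel

/-- The distance to a given point attains its minimum on orbits under subsets of the affine Weyl
group. -/
theorem exists_dist_min [FiniteDimensional ℝ E] {Φ : Set E} (hΦ : IsRootSystem Φ)
    {L : AddSubgroup E} [DiscreteTopology L] (hL : IsSubweight Φ L)
    (A : Set (E ≃ᵃⁱ[ℝ] E)) (hA : A ⊆ affineWeylGroup Φ) (hne : A.Nonempty) (x y : E) :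
    ∃ ρ ∈ A, ∀ σ ∈ A, dist (ρ x) y ≤ dist (σ x) y := by
  obtain ⟨ρ₀, hρ₀⟩ := hne
  set R := dist (ρ₀ x) y with hR
  -- Each of the finitely many linear parts `w` contributes points of `w x + L`, and discreteness of
  -- `L` leaves finitely many in a ball.
  have hfin : ((fun ρ : E ≃ᵃⁱ[ℝ] E => ρ x) '' A ∩ Metric.closedBall y R).Finite := by
    have hb : ∀ w ∈ (weylGroup Φ : Set (E ≃ₗᵢ[ℝ] E)),
        ((fun l => w x + l) '' (Metric.closedBall (y - w x) R ∩ (L : Set E))).Finite :=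
      fun w _ => (Metric.finite_isBounded_inter_isClosed
        (SetLike.isDiscrete_iff_discreteTopology.mpr inferInstance) Metric.isBounded_closedBall
        (AddSubgroup.isClosed_of_discrete (H := L))).image _
    refine (hΦ.finite_weylGroup.biUnion hb).subset ?_
    rintro _ ⟨⟨ρ, hρ, rfl⟩, hball⟩
    obtain ⟨w, hw, l, hl, hρx⟩ := hΦ.mem_affineWeylGroup_iff.mp (hA hρ)
    refine Set.mem_biUnion hw ⟨l, ⟨?_, hL.rootLattice_le hl⟩, (hρx x).symm⟩
    rw [Metric.mem_closedBall, dist_eq_norm] at hball ⊢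
    convert hball using 2
    change _ = ρ x - y
    rw [hρx]
    abel
  obtain ⟨_, ⟨⟨ρ, hρ, rfl⟩, hball⟩, hmin⟩ := Set.exists_min_image _ (fun z => dist z y) hfin
    ⟨ρ₀ x, ⟨ρ₀, hρ₀, rfl⟩, Metric.mem_closedBall.mpr le_rfl⟩
  refine ⟨ρ, hρ, fun σ hσ => ?_⟩
  by_cases h : dist (σ x) y ≤ R
  · exact hmin _ ⟨⟨σ, hσ, rfl⟩, h⟩
  · exact (Metric.mem_closedBall.mp hball).trans (not_le.mp h).le

/-! ### The alcove of a base point and its walls -/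

/-- `p` lies in the interior of the fundamental alcove determined by `ξ`. -/
structure IsBasePoint (Φ : Set E) (ξ p : E) : Prop where
  regular : IsRegular Φ ξ
  pos : ∀ r ∈ Φ, 0 < inner ℝ ξ r → 0 < corootPairing p r
  lt_one : ∀ r ∈ Φ, 0 < inner ℝ ξ r → corootPairing p r < 1

/-- A small positive multiple of `ξ` works, because only finitely many upper bounds must be met. -/
theorem exists_isBasePoint {Φ : Set E} (hΦ : IsRootSystem Φ) {ξ : E} (hξ : IsRegular Φ ξ) :
    ∃ p, IsBasePoint Φ ξ p := by
  have hev : ∀ᶠ t : ℝ in nhds 0, ∀ r ∈ Φ, t * corootPairing ξ r < 1 := by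
    refine (Filter.eventually_all_finite hΦ.finite).mpr fun r _ => ?_
    have hc : Continuous fun t : ℝ => t * corootPairing ξ r := by fun_prop
    exact hc.continuousAt.eventually_lt continuousAt_const (by simp)
  obtain ⟨t, ht, ht0⟩ := ((hev.filter_mono nhdsWithin_le_nhds).and
    (self_mem_nhdsWithin : Set.Ioi (0 : ℝ) ∈ nhdsWithin 0 (Set.Ioi 0))).exists
  refine ⟨t • ξ, hξ, fun r hr h => ?_, fun r hr _ => ?_⟩
  · rw [corootPairing_smul, corootPairing]
    have := norm_pos_iff.mpr (hΦ.ne_zero hr)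
    have ht0' : 0 < t := ht0
    positivity
  · rw [corootPairing_smul]
    exact ht r hr

/-- The affine roots that are positive at `p`. -/
def positiveAffineRoots (Φ : Set E) (p : E) : Set (E × ℤ) := {a | a.1 ∈ Φ ∧ 0 < level a p}

/-- The open alcove containing `p`. -/
def openAlcove (Φ : Set E) (p : E) : Set E := {x | ∀ a ∈ positiveAffineRoots Φ p, 0 < level a x}

/-- The affine roots that define the walls of the alcove containing `p`. -/
def wallRoots (Φ : Set E) (p : E) : Set (E × ℤ) :=
  {a | a ∈ positiveAffineRoots Φ p ∧ ∀ b ∈ positiveAffineRoots Φ p,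
    level b (affineReflection a p) < 0 → affineReflection b = affineReflection a}

theorem IsRegular.inner_neg_pos {Φ : Set E} {ξ r : E} (hξ : IsRegular Φ ξ)
    (hr : r ∈ Φ) (h : ¬ 0 < inner ℝ ξ r) : 0 < inner ℝ ξ (-r) := by
  rw [inner_neg_right]
  exact neg_pos.mpr (lt_of_le_of_ne (not_lt.mp h) (hξ r hr))

/-- A positive affine root dominates one of the form `(r, 0)` or `(-r, -1)` with `0 < ⟨ξ, r⟩`. -/
theorem IsBasePoint.exists_le_level {Φ : Set E} (hΦ : IsRootSystem Φ) {ξ p : E}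
    (hp : IsBasePoint Φ ξ p) {a : E × ℤ} (ha : a ∈ positiveAffineRoots Φ p) :
    (0 < inner ℝ ξ a.1 ∧ ∀ x, corootPairing x a.1 ≤ level a x) ∨
      (0 < inner ℝ ξ (-a.1) ∧ ∀ x, 1 - corootPairing x (-a.1) ≤ level a x) := by
  obtain ⟨r, k⟩ := a
  obtain ⟨hr, hl⟩ := ha
  simp only [level] at hl hr ⊢
  by_cases h : 0 < inner ℝ ξ r
  · left
    refine ⟨h, fun x => ?_⟩
    -- Positivity at `p` gives `k < corootPairing p r < 1`; integrality sharpens this to `k ≤ 0`. In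
    -- the other case it yields `k ≤ -1`.
    have : (k : ℝ) < (1 : ℤ) := by
      push_cast
      linarith [hp.lt_one r hr h]
    have hk : (k : ℝ) ≤ (0 : ℤ) := Int.cast_le.mpr (Int.lt_add_one_iff.mp (Int.cast_lt.mp this))
    push_cast at hk
    linarith
  · right
    have h' := hp.regular.inner_neg_pos hr h
    refine ⟨h', fun x => ?_⟩
    have h1 := hp.pos _ (hΦ.neg_mem hr) h'
    rw [corootPairing_neg_right] at h1 ⊢
    have : (k : ℝ) < (0 : ℤ) := by
      push_cast
      linarith
    have hk : (k : ℝ) ≤ (-1 : ℤ) := Int.cast_le.mpr (Int.le_sub_one_of_lt (Int.cast_lt.mp this))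
    push_cast at hk
    linarith

/-- The pairing of `p` with a root lies strictly between consecutive integers. Thus every affine
root has a definite sign at `p`. -/
theorem IsBasePoint.level_ne_zero {Φ : Set E} (hΦ : IsRootSystem Φ) {ξ p : E}
    (hp : IsBasePoint Φ ξ p) {a : E × ℤ} (ha : a.1 ∈ Φ) : level a p ≠ 0 := by
  obtain ⟨r, k⟩ := a
  simp only [level] at ha ⊢
  intro h
  rw [sub_eq_zero] at h
  by_cases h0 : 0 < inner ℝ ξ r
  · have h1 := hp.pos r ha h0
    have h2 := hp.lt_one r ha h0
    rw [h] at h1 h2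
    have h1' : 0 < k := by exact_mod_cast h1
    have h2' : k < 1 := by exact_mod_cast h2
    omega
  · have h' := hp.regular.inner_neg_pos ha h0
    have h1 := hp.pos _ (hΦ.neg_mem ha) h'
    have h2 := hp.lt_one _ (hΦ.neg_mem ha) h'
    rw [corootPairing_neg_right, h] at h1 h2
    have h1' : 0 < -k := by exact_mod_cast h1
    have h2' : -k < 1 := by exact_mod_cast h2
    omega

theorem IsBasePoint.zero_mem {Φ : Set E} {ξ p : E} (hp : IsBasePoint Φ ξ p) {r : E} (hr : r ∈ Φ)
    (h : 0 < inner ℝ ξ r) : (r, (0 : ℤ)) ∈ positiveAffineRoots Φ p := by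
  refine ⟨hr, ?_⟩
  simpa [level] using hp.pos r hr h

theorem IsBasePoint.neg_one_mem {Φ : Set E} (hΦ : IsRootSystem Φ) {ξ p : E}
    (hp : IsBasePoint Φ ξ p) {r : E} (hr : r ∈ Φ)
    (h : 0 < inner ℝ ξ r) : (-r, (-1 : ℤ)) ∈ positiveAffineRoots Φ p := by
  refine ⟨hΦ.neg_mem hr, ?_⟩
  have := hp.lt_one r hr h
  simp only [level, corootPairing_neg_right]
  push_cast
  linarith

/-- Describing `C` by all affine roots, not just the two bounds per positive root, suits the action
of `W ⋉ L`, which permutes affine roots. -/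
theorem IsBasePoint.mem_fundamentalAlcove_iff {Φ : Set E} (hΦ : IsRootSystem Φ) {ξ p : E}
    (hp : IsBasePoint Φ ξ p) {x : E} :
    x ∈ fundamentalAlcove Φ ξ ↔ ∀ a ∈ positiveAffineRoots Φ p, 0 ≤ level a x := by
  constructor
  · intro hx a ha
    rcases hp.exists_le_level hΦ ha with ⟨h, hle⟩ | ⟨h, hle⟩
    · exact (hx _ ha.1 h).1.trans (hle x)
    · exact (sub_nonneg.mpr (hx _ (hΦ.neg_mem ha.1) h).2).trans (hle x)
  · intro hx r hr h
    have h1 := hx _ (hp.zero_mem hr h)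
    have h2 := hx _ (hp.neg_one_mem hΦ hr h)
    simp only [level, corootPairing_neg_right] at h1 h2
    push_cast at h1 h2
    constructor <;> linarith

/-- Finitely many affine roots define the open alcove. -/
theorem IsBasePoint.exists_finite_defining {Φ : Set E} (hΦ : IsRootSystem Φ) {ξ p : E}
    (hp : IsBasePoint Φ ξ p) : ∃ A ⊆ positiveAffineRoots Φ p, A.Finite ∧
      ∀ x, (∀ a ∈ A, 0 < level a x) → x ∈ openAlcove Φ p := by
  refine ⟨{a ∈ positiveAffineRoots Φ p | a.2 ∈ ({0, -1} : Set ℤ)}, fun a ha => ha.1,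
    (hΦ.finite.prod (Set.toFinite ({0, -1} : Set ℤ))).subset fun a ha => ⟨ha.1.1, ha.2⟩, ?_⟩
  intro x hx a ha
  rcases hp.exists_le_level hΦ ha with ⟨h, hle⟩ | ⟨h, hle⟩
  · have h1 := hx _ ⟨hp.zero_mem ha.1 h, Or.inl rfl⟩
    simp only [level] at h1
    push_cast at h1
    linarith [hle x]
  · have h1 := hx _ ⟨hp.neg_one_mem hΦ (hΦ.neg_mem ha.1) h, Or.inr rfl⟩
    simp only [level, corootPairing_neg_right] at h1
    push_cast at h1
    have := hle x
    rw [corootPairing_neg_right] at this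
    linarith

/-- If the affine functions in a finite set of affine roots determine the open alcove, then the
weak inequalities determine its closure. -/
theorem level_nonneg_of_defining {Φ : Set E} {p : E} {S : Set (E × ℤ)}
    (hS : S ⊆ positiveAffineRoots Φ p)
    (hdef : ∀ x, (∀ a ∈ S, 0 < level a x) → x ∈ openAlcove Φ p) {z : E}
    (hz : ∀ a ∈ S, 0 ≤ level a z) {b : E × ℤ} (hb : b ∈ positiveAffineRoots Φ p) :
    0 ≤ level b z := by
  by_contra! hneg
  have hbp : 0 < level b p := hb.2
  -- The parameter at which `level b` vanishes on the segment from `z` to `p`; past `z` that segment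
  -- lies in the open alcove.
  set t : ℝ := -level b z / (level b p - level b z) with ht
  have hd : 0 < level b p - level b z := by linarith
  have ht0 : 0 < t := div_pos (by linarith) hd
  have ht1 : t < 1 := (div_lt_one hd).mpr (by linarith)
  have hmem : z + t • (p - z) ∈ openAlcove Φ p := by
    refine hdef _ fun a ha => ?_
    rw [level_lineMap]
    have h1 := mul_nonneg (sub_pos.mpr ht1).le (hz a ha)
    have h2 := mul_pos ht0 (hS ha).2
    linarith
  have := hmem b hb
  rw [level_lineMap] at this
  have h0 : t * (level b p - level b z) = -level b z := div_mul_cancel₀ _ hd.ne'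
  linarith

/-- A vector orthogonal to `r` and on the negative side of `s`, when `s` is no multiple of `r`. -/
theorem exists_orthogonal_neg {r s : E} (hr : r ≠ 0) (h : ∀ c : ℝ, s ≠ c • r) :
    ∃ d : E, corootPairing d r = 0 ∧ corootPairing d s < 0 := by
  have hrr : inner ℝ r r ≠ (0 : ℝ) := inner_self_ne_zero.mpr hr
  -- The component of `s` orthogonal to `r`, nonzero by hypothesis; its negative is the witness.
  set e := s - (inner ℝ s r / inner ℝ r r : ℝ) • r with he
  have he0 : e ≠ 0 := sub_ne_zero.mpr (h _)
  have her : inner ℝ e r = (0 : ℝ) := by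
    rw [he, inner_sub_left, real_inner_smul_left, div_mul_cancel₀ _ hrr, sub_self]
  have hes : inner ℝ e s = inner ℝ e e := by
    have : s = e + (inner ℝ s r / inner ℝ r r : ℝ) • r := by rw [he, sub_add_cancel]
    conv_lhs => rw [this]
    rw [inner_add_right, real_inner_smul_right, her, mul_zero, add_zero]
  have hs0 : s ≠ 0 := fun hs => h 0 (by rw [hs, zero_smul])
  refine ⟨-e, by rw [corootPairing, inner_neg_left, her]; simp, ?_⟩
  rw [corootPairing_neg_left, neg_lt_zero, corootPairing, hes, real_inner_self_eq_norm_sq]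
  have h1 := norm_pos_iff.mpr he0
  have h2 := norm_pos_iff.mpr hs0
  positivity

/-- An irredundant defining affine root is a wall. -/
theorem mem_wallRoots_of_minimal {Φ : Set E} (hΦ : IsRootSystem Φ) {p : E}
    {S : Set (E × ℤ)} (hfin : S.Finite)
    (hS : S ⊆ positiveAffineRoots Φ p)
    (hdef : ∀ x, (∀ a ∈ S, 0 < level a x) → x ∈ openAlcove Φ p) {a : E × ℤ} (ha : a ∈ S)
    {y : E} (hy : ∀ b ∈ S, b ≠ a → 0 < level b y) (hya : level a y ≤ 0) :
    a ∈ wallRoots Φ p := by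
  have hap : 0 < level a p := (hS ha).2
  have ha0 : a.1 ≠ 0 := hΦ.ne_zero (hS ha).1
  -- The segment from `y` to `p` crosses the hyperplane of `a` at a point in the relative interior
  -- of that face.
  obtain ⟨z, hza, hz⟩ : ∃ z, level a z = 0 ∧ ∀ b ∈ S, b ≠ a → 0 < level b z := by
    have hd : 0 < level a p - level a y := by linarith
    refine ⟨y + (-level a y / (level a p - level a y)) • (p - y), ?_, fun b hb hba => ?_⟩
    · rw [level_lineMap]
      field_simp
      ring
    · rw [level_lineMap]
      have ht0 : 0 ≤ -level a y / (level a p - level a y) := div_nonneg (by linarith) hd.le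
      have ht1 : -level a y / (level a p - level a y) < 1 := (div_lt_one hd).mpr (by linarith)
      have h1 := mul_pos (sub_pos.mpr ht1) (hy b hb hba)
      have h2 := mul_nonneg ht0 (hS hb).2.le
      linarith
  have hnn : ∀ b ∈ positiveAffineRoots Φ p, 0 ≤ level b z := fun b hb =>
    level_nonneg_of_defining hS hdef (fun c hc => by
      by_cases hca : c = a
      · rw [hca, hza]
      · exact (hz c hc hca).le) hb
  -- No other hyperplane passes through `z`: otherwise a small move along the hyperplane of `a`
  -- would make `b` negative while keeping all constraints in `S`.
  have hzero : ∀ b ∈ positiveAffineRoots Φ p, level b z = 0 →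
      affineReflection b = affineReflection a := by
    intro b hb hbz
    by_cases hpar : ∃ c : ℝ, b.1 = c • a.1
    · obtain ⟨c, hc⟩ := hpar
      exact affineReflection_eq_of_smul ha0 (hΦ.ne_zero hb.1) hc hza hbz
    · exfalso
      push Not at hpar
      obtain ⟨d, hda, hdb⟩ := exists_orthogonal_neg ha0 hpar
      have hev : ∀ᶠ t : ℝ in nhds 0, ∀ c ∈ S, c ≠ a → 0 < level c (z + t • d) := by
        refine (Filter.eventually_all_finite hfin).mpr fun c hc => ?_
        by_cases hca : c = a
        · exact Filter.Eventually.of_forall fun t h => absurd hca h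
        · have hcont : Continuous fun t : ℝ => level c (z + t • d) :=
            (continuous_level c).comp (by fun_prop)
          have h0 : (0 : ℝ) < level c (z + (0 : ℝ) • d) := by
            rw [zero_smul, add_zero]
            exact hz c hc hca
          filter_upwards [continuousAt_const.eventually_lt hcont.continuousAt h0] with t ht _
          exact ht
      obtain ⟨t, ht, ht0⟩ := ((hev.filter_mono nhdsWithin_le_nhds).and
        (self_mem_nhdsWithin : Set.Ioi (0 : ℝ) ∈ nhdsWithin 0 (Set.Ioi 0))).exists
      have ht0' : 0 < t := ht0
      have hge := level_nonneg_of_defining hS hdef (z := z + t • d) (fun c hc => by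
        by_cases hca : c = a
        · rw [hca, level_add_smul, hza, hda, mul_zero, add_zero]
        · exact (ht c hc hca).le) hb
      rw [level_add_smul, hbz, zero_add] at hge
      exact absurd hge (not_le.mpr (mul_neg_of_pos_of_neg ht0' hdb))
  refine ⟨hS ha, fun b hb hneg => hzero b hb ?_⟩
  by_contra hbz
  have hbz' : 0 < level b z := lt_of_le_of_ne (hnn b hb) (Ne.symm hbz)
  -- The pullback `c` of `b` by the reflection of `a` is negative at `p` but positive at the fixed
  -- point `z`, so `-c` violates `hnn`.
  obtain ⟨c, hc, hcl, -⟩ := (hΦ.mem_affineWeylGroup_iff.mp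
    (affineReflection_mem (hS ha).1)).exists_level_comp hΦ hΦ.isSubweight_rootLattice hb.1
  rw [hcl] at hneg
  have hcz : 0 < level c z := by
    rwa [← hcl, affineReflection_eq_self hza]
  have := hnn (-c) ⟨hΦ.neg_mem hc, by rw [level_neg]; linarith⟩
  rw [level_neg] at this
  linarith

/-- A point outside the open alcove lies on or beyond one of its walls. -/
theorem IsBasePoint.exists_wallRoot {Φ : Set E} (hΦ : IsRootSystem Φ) {ξ p : E}
    (hp : IsBasePoint Φ ξ p) {x : E} (hx : x ∉ openAlcove Φ p) :
    ∃ a ∈ wallRoots Φ p, level a x ≤ 0 := by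
  obtain ⟨A, hA, hfin, hdef⟩ := hp.exists_finite_defining hΦ
  have hfin' : {S | S ⊆ A ∧ ∀ x, (∀ a ∈ S, 0 < level a x) → x ∈ openAlcove Φ p}.Finite :=
    hfin.finite_subsets.subset fun S hS => hS.1
  obtain ⟨S, ⟨hSA, hSdef⟩, hmin⟩ := hfin'.exists_minimal ⟨A, subset_rfl, hdef⟩
  obtain ⟨a, ha, hax⟩ : ∃ a ∈ S, level a x ≤ 0 := by
    by_contra! h
    exact hx (hSdef x h)
  refine ⟨a, ?_, hax⟩
  -- By minimality, `S` without `a` no longer defines the alcove.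
  obtain ⟨y, hy, hya⟩ : ∃ y, (∀ b ∈ S, b ≠ a → 0 < level b y) ∧ y ∉ openAlcove Φ p := by
    by_contra! h
    have hsub := hmin (y := S \ {a}) ⟨Set.sdiff_subset.trans hSA, fun y hy =>
      h y fun b hb hba => hy b ⟨hb, hba⟩⟩ Set.sdiff_subset
    exact (hsub ha).2 rfl
  refine mem_wallRoots_of_minimal hΦ (hfin.subset hSA)
    (hSA.trans hA) hSdef ha hy ?_
  by_contra! hpos
  refine hya (hSdef y fun b hb => ?_)
  by_cases hba : b = a
  · rwa [hba]
  · exact hy b hb hba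

/-! ### The fundamental alcove is a strict fundamental domain -/

theorem IsBasePoint.level_apply_ne_zero {Φ : Set E} (hΦ : IsRootSystem Φ) {ξ p : E}
    (hp : IsBasePoint Φ ξ p) {L : AddSubgroup E} (hL : IsSubweight Φ L) {ρ : E ≃ᵃⁱ[ℝ] E}
    (hρ : IsExtended Φ L ρ) {a : E × ℤ} (ha : a.1 ∈ Φ) : level a (ρ p) ≠ 0 := by
  obtain ⟨b, hb, hbl, -⟩ := hρ.exists_level_comp hΦ hL ha
  rw [hbl]
  exact hp.level_ne_zero hΦ hb

theorem IsBasePoint.mem_fundamentalAlcove {Φ : Set E} (hΦ : IsRootSystem Φ) {ξ p : E}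
    (hp : IsBasePoint Φ ξ p) : p ∈ fundamentalAlcove Φ ξ :=
  (hp.mem_fundamentalAlcove_iff hΦ).mpr fun _ ha => ha.2.le

/-- Every orbit of the affine Weyl group meets the fundamental alcove. -/
theorem IsBasePoint.exists_apply_mem [FiniteDimensional ℝ E] {Φ : Set E} (hΦ : IsRootSystem Φ)
    {ξ p : E} (hp : IsBasePoint Φ ξ p) {L : AddSubgroup E} [DiscreteTopology L]
    (hL : IsSubweight Φ L) (v : E) :
    ∃ ρ ∈ affineWeylGroup Φ, ρ v ∈ fundamentalAlcove Φ ξ := by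
  obtain ⟨ρ, hρ, hmin⟩ := exists_dist_min hΦ hL (affineWeylGroup Φ) subset_rfl ⟨1, one_mem _⟩ v p
  refine ⟨ρ, hρ, (hp.mem_fundamentalAlcove_iff hΦ).mpr fun a ha => ?_⟩
  by_contra! hneg
  exact (hmin (affineReflection a * ρ) (mul_mem (affineReflection_mem ha.1) hρ)).not_gt
    (dist_affineReflection_lt (hΦ.ne_zero ha.1) hneg ha.2)

/-- The reflections in the walls of the alcove of `p`. -/
def wallReflections (Φ : Set E) (p : E) : Set (E ≃ᵃⁱ[ℝ] E) := affineReflection '' wallRoots Φ p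

theorem closure_wallReflections_le (Φ : Set E) (p : E) :
    Subgroup.closure (wallReflections Φ p) ≤ affineWeylGroup Φ := by
  refine (Subgroup.closure_le _).mpr ?_
  rintro _ ⟨a, ha, rfl⟩
  exact affineReflection_mem ha.1.1

/-- The wall reflections generate the affine Weyl group. -/
theorem IsBasePoint.affineWeylGroup_le_closure [FiniteDimensional ℝ E] {Φ : Set E}
    (hΦ : IsRootSystem Φ) {ξ p : E} (hp : IsBasePoint Φ ξ p) {L : AddSubgroup E}
    [DiscreteTopology L] (hL : IsSubweight Φ L) :
    affineWeylGroup Φ ≤ Subgroup.closure (wallReflections Φ p) := by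
  set H := Subgroup.closure (wallReflections Φ p) with hH
  refine hΦ.affineWeylGroup_le fun a ha => ?_
  have hHG : H ≤ affineWeylGroup Φ := closure_wallReflections_le Φ p
  -- Among the `H`-conjugates of the reflection, take one that moves `p` least; it will turn out to
  -- be a wall reflection.
  obtain ⟨ρ, ⟨u, hu, rfl⟩, hmin⟩ := exists_dist_min hΦ hL
    {ρ | ∃ u ∈ H, u⁻¹ * affineReflection a * u = ρ}
    (by
      rintro _ ⟨u, hu, rfl⟩
      exact mul_mem (mul_mem (inv_mem (hHG hu)) (affineReflection_mem ha)) (hHG hu))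
    ⟨_, 1, one_mem _, rfl⟩ p p
  suffices hmem : u⁻¹ * affineReflection a * u ∈ H by
    have := mul_mem (mul_mem hu hmem) (inv_mem hu)
    simpa [mul_assoc] using this
  obtain ⟨b, hb, hbc⟩ : ∃ b ∈ positiveAffineRoots Φ p,
      u⁻¹ * affineReflection a * u = affineReflection b := by
    obtain ⟨b, hb, -, hbc⟩ := (hΦ.mem_affineWeylGroup_iff.mp (hHG hu)).exists_level_comp hΦ
      hΦ.isSubweight_rootLattice ha
    have hbc' : u⁻¹ * affineReflection a * u = affineReflection b := by
      rw [mul_assoc, hbc, inv_mul_cancel_left]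
    rcases lt_or_gt_of_ne (hp.level_ne_zero hΦ hb) with h | h
    · exact ⟨-b, ⟨hΦ.neg_mem hb, by rw [level_neg]; linarith⟩, by rw [hbc', affineReflection_neg]⟩
    · exact ⟨b, ⟨hb, h⟩, hbc'⟩
  rw [hbc] at hmin ⊢
  have hb0 := hΦ.ne_zero hb.1
  have hout : affineReflection b p ∉ openAlcove Φ p := by
    intro h
    have h1 := h b hb
    rw [level_affineReflection_self hb0] at h1
    linarith [hb.2]
  obtain ⟨s, hs, hsl⟩ := hp.exists_wallRoot hΦ hout
  have hs0 := hΦ.ne_zero hs.1.1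
  have hsH : affineReflection s ∈ H := Subgroup.subset_closure ⟨s, hs, rfl⟩
  have hbp := hb.2
  have hsp := hs.1.2
  -- The wall `s` is met on the way from `p` to its mirror image, so `b` and `s` form an acute
  -- angle. Conjugating by `s` would then reduce the displacement, unless `b` separates `p` from its
  -- image under `s`; in that case the wall property identifies the two reflections.
  have hlt : level b (affineReflection s p) < level b p := by
    rw [level_affineReflection] at hsl ⊢
    have h1 : 0 < level b p * corootPairing b.1 s.1 := by linarith
    have h2 : 0 < corootPairing b.1 s.1 := (mul_pos_iff_of_pos_left hbp).mp h1
    have h3 : 0 < corootPairing s.1 b.1 := by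
      have hnb := norm_pos_iff.mpr hb0
      have hns := norm_pos_iff.mpr hs0
      rw [corootPairing, div_pos_iff_of_pos_right (by positivity)] at h2 ⊢
      rwa [real_inner_comm]
    linarith [mul_pos hsp h3]
  by_cases hneg : level b (affineReflection s p) < 0
  · rw [hs.2 b hb hneg]
    exact hsH
  · exfalso
    have hle := hmin (affineReflection s * affineReflection b * affineReflection s)
      ⟨u * affineReflection s, mul_mem hu hsH, by
        rw [mul_inv_rev, affineReflection_inv hs0, ← hbc]
        simp only [mul_assoc]⟩
    have hd : dist ((affineReflection s * affineReflection b * affineReflection s) p) p =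
        dist (affineReflection b (affineReflection s p)) (affineReflection s p) := by
      change dist (affineReflection s (affineReflection b (affineReflection s p))) p = _
      rw [← (affineReflection s).dist_map, affineReflection_affineReflection hs0]
    rw [hd, dist_affineReflection, dist_affineReflection, abs_of_pos hbp,
      abs_of_nonneg (not_lt.mp hneg)] at hle
    have := le_of_mul_le_mul_right hle (norm_pos_iff.mpr hb0)
    linarith

theorem list_prod_mem {Φ : Set E} {p : E} {l : List (E ≃ᵃⁱ[ℝ] E)}
    (hl : ∀ s ∈ l, s ∈ wallReflections Φ p) : l.prod ∈ affineWeylGroup Φ :=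
  closure_wallReflections_le Φ p
    (Subgroup.list_prod_mem _ fun s hs => Subgroup.subset_closure (hl s hs))

/-- The exchange property: if the wall of `a` separates `p` from its image under a word in the wall
reflections, then multiplying by the reflection of `a` deletes a letter. -/
theorem IsBasePoint.exchange {Φ : Set E} (hΦ : IsRootSystem Φ) {ξ p : E}
    (hp : IsBasePoint Φ ξ p) {a : E × ℤ} (ha : a ∈ wallRoots Φ p) (l : List (E ≃ᵃⁱ[ℝ] E))
    (hl : ∀ s ∈ l, s ∈ wallReflections Φ p) (hneg : level a (l.prod p) < 0) :
    ∃ l' : List (E ≃ᵃⁱ[ℝ] E), (∀ s ∈ l', s ∈ wallReflections Φ p) ∧ l'.length + 1 = l.length ∧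
      l'.prod = affineReflection a * l.prod := by
  induction l using List.reverseRecOn with
  | nil => exact absurd hneg (not_lt.mpr ha.1.2.le)
  | append_singleton l s ih =>
    have hl0 : ∀ s ∈ l, s ∈ wallReflections Φ p := fun s hs => hl s (List.mem_append_left _ hs)
    have hs : s ∈ wallReflections Φ p := hl s (by simp)
    by_cases h : level a (l.prod p) < 0
    · obtain ⟨l', hl', hlen, hprod⟩ := ih hl0 h
      refine ⟨l' ++ [s], ?_, by simp [hlen], by simp [hprod, mul_assoc]⟩
      intro t ht
      rcases List.mem_append.mp ht with ht | ht
      · exact hl' t ht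
      · rwa [List.mem_singleton.mp ht]
    · refine ⟨l, hl0, by simp, ?_⟩
      obtain ⟨b, hb, rfl⟩ := hs
      obtain ⟨c, hc, hcl, hconj⟩ := (hΦ.mem_affineWeylGroup_iff.mp
        (list_prod_mem hl0)).exists_level_comp hΦ hΦ.isSubweight_rootLattice ha.1.1
      -- Here the last letter makes the crossing: `c`, the pullback of `a` by the prefix, separates
      -- `p` from its image under that letter, so its reflection is that letter and the two cancel.
      have hcp : 0 < level c p :=
        lt_of_le_of_ne (by rw [← hcl]; exact not_lt.mp h) (hp.level_ne_zero hΦ hc).symm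
      have hcb : affineReflection c = affineReflection b := by
        refine hb.2 c ⟨hc, hcp⟩ ?_
        rw [← hcl]
        simpa using hneg
      rw [List.prod_append, List.prod_singleton, ← mul_assoc, hconj, hcb, mul_assoc,
        affineReflection_mul_self (hΦ.ne_zero hb.1.1), mul_one]

/-- The tail of the word must send `p` across the wall of the first letter, so exchange absorbs that
letter and gives a word two letters shorter with the same product. -/
theorem IsBasePoint.list_prod_eq_one {Φ : Set E} (hΦ : IsRootSystem Φ) {ξ p : E}
    (hp : IsBasePoint Φ ξ p) (n : ℕ) : ∀ l : List (E ≃ᵃⁱ[ℝ] E), l.length = n →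
      (∀ s ∈ l, s ∈ wallReflections Φ p) → l.prod p ∈ openAlcove Φ p → l.prod = 1 := by
  induction n using Nat.strong_induction_on with
  | _ n ih =>
    intro l hlen hl hmem
    cases l with
    | nil => rfl
    | cons s l =>
      have hl0 : ∀ t ∈ l, t ∈ wallReflections Φ p := fun t ht => hl t (List.mem_cons_of_mem _ ht)
      obtain ⟨a, ha, has⟩ := hl s List.mem_cons_self
      rw [List.prod_cons, ← has] at hmem ⊢
      have hpos : 0 < level a (affineReflection a (l.prod p)) := hmem a ha.1
      rw [level_affineReflection_self (hΦ.ne_zero ha.1.1)] at hpos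
      obtain ⟨l', hl', hlen', hprod⟩ := hp.exchange hΦ ha l hl0 (neg_pos.mp hpos)
      rw [← hprod] at hmem ⊢
      rw [List.length_cons] at hlen
      exact ih l'.length (by omega) l' rfl hl' hmem

/-- The affine Weyl group acts freely on the set of alcoves. -/
theorem IsBasePoint.eq_one_of_mem_openAlcove [FiniteDimensional ℝ E] {Φ : Set E}
    (hΦ : IsRootSystem Φ) {ξ p : E} (hp : IsBasePoint Φ ξ p) {L : AddSubgroup E}
    [DiscreteTopology L] (hL : IsSubweight Φ L) {ρ : E ≃ᵃⁱ[ℝ] E} (hρ : ρ ∈ affineWeylGroup Φ)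
    (h : ρ p ∈ openAlcove Φ p) : ρ = 1 := by
  have hcl := hp.affineWeylGroup_le_closure hΦ hL hρ
  rw [← Subgroup.mem_toSubmonoid, Subgroup.closure_toSubmonoid] at hcl
  obtain ⟨l, hl, rfl⟩ := Submonoid.exists_list_of_mem_closure hcl
  refine hp.list_prod_eq_one hΦ _ l rfl (fun s hs => ?_) h
  rcases hl s hs with h | ⟨a, ha, has⟩
  · exact h
  · refine ⟨a, ha, ?_⟩
    rw [← affineReflection_inv (hΦ.ne_zero ha.1.1), has, inv_inv]

/-- If an element of `W ⋉ L` sends `p` into the closed alcove, it sends `p` into the open one. -/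
theorem IsBasePoint.apply_mem_openAlcove {Φ : Set E} (hΦ : IsRootSystem Φ) {ξ p : E}
    (hp : IsBasePoint Φ ξ p) {L : AddSubgroup E} (hL : IsSubweight Φ L) {ρ : E ≃ᵃⁱ[ℝ] E}
    (hρ : IsExtended Φ L ρ) (h : ρ p ∈ fundamentalAlcove Φ ξ) : ρ p ∈ openAlcove Φ p :=
  fun a ha => lt_of_le_of_ne ((hp.mem_fundamentalAlcove_iff hΦ).mp h a ha)
    (hp.level_apply_ne_zero hΦ hL hρ ha.1).symm

/-- Points of the fundamental alcove in the same orbit of the affine Weyl group are equal. -/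
theorem IsBasePoint.apply_eq_self [FiniteDimensional ℝ E] {Φ : Set E}
    (hΦ : IsRootSystem Φ) {ξ p : E} (hp : IsBasePoint Φ ξ p) {L : AddSubgroup E}
    [DiscreteTopology L] (hL : IsSubweight Φ L) {ρ : E ≃ᵃⁱ[ℝ] E} (hρ : ρ ∈ affineWeylGroup Φ)
    {y : E} (hy : y ∈ fundamentalAlcove Φ ξ) (hρy : ρ y ∈ fundamentalAlcove Φ ξ) : ρ y = y := by
  -- Choose `σ` agreeing with `ρ` at `y` with `σ p` nearest to `p`. A hyperplane separating `σ p`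
  -- from `p` must contain `σ y`, so reflecting in it keeps `σ y` and contradicts minimality.
  obtain ⟨σ, ⟨hσ, hσy⟩, hmin⟩ := exists_dist_min hΦ hL
    {σ | σ ∈ affineWeylGroup Φ ∧ σ y = ρ y} (fun σ h => h.1) ⟨ρ, hρ, rfl⟩ p p
  have hopen : σ p ∈ openAlcove Φ p := by
    intro a ha
    have hσ' := hΦ.mem_affineWeylGroup_iff.mp hσ
    refine lt_of_le_of_ne ?_ (hp.level_apply_ne_zero hΦ hΦ.isSubweight_rootLattice hσ' ha.1).symm
    by_contra! hneg
    obtain ⟨b, hb, hbl, -⟩ := hσ'.exists_level_comp hΦ hΦ.isSubweight_rootLattice ha.1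
    have h1 : 0 ≤ level a (σ y) := by
      rw [hσy]
      exact (hp.mem_fundamentalAlcove_iff hΦ).mp hρy a ha
    have h2 : level a (σ y) ≤ 0 := by
      rw [hbl] at hneg ⊢
      have := (hp.mem_fundamentalAlcove_iff hΦ).mp hy (-b)
        ⟨hΦ.neg_mem hb, by rw [level_neg]; linarith⟩
      rw [level_neg] at this
      linarith
    refine (hmin (affineReflection a * σ) ⟨mul_mem (affineReflection_mem ha.1) hσ, ?_⟩).not_gt
      (dist_affineReflection_lt (hΦ.ne_zero ha.1) hneg ha.2)
    rw [← hσy]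
    exact affineReflection_eq_self (le_antisymm h2 h1)
  rw [← hσy, hp.eq_one_of_mem_openAlcove hΦ hL hσ hopen]
  rfl

/-! ### Transformations of the fundamental alcove -/

/-- One point suffices as a test: `ψ` permutes affine roots, and their signs at `p` and `ψ p` decide
which are positive. -/
theorem IsBasePoint.image_fundamentalAlcove {Φ : Set E} (hΦ : IsRootSystem Φ) {ξ p : E}
    (hp : IsBasePoint Φ ξ p) {L : AddSubgroup E} (hL : IsSubweight Φ L) {ψ : E ≃ᵃⁱ[ℝ] E}
    (hψ : IsExtended Φ L ψ) (h : ψ p ∈ fundamentalAlcove Φ ξ) :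
    ψ '' fundamentalAlcove Φ ξ = fundamentalAlcove Φ ξ := by
  have hopen := hp.apply_mem_openAlcove hΦ hL hψ h
  apply Set.Subset.antisymm
  · rintro _ ⟨x, hx, rfl⟩
    rw [hp.mem_fundamentalAlcove_iff hΦ] at hx ⊢
    intro a ha
    obtain ⟨b, hb, hbl, -⟩ := hψ.exists_level_comp hΦ hL ha.1
    rw [hbl]
    exact hx b ⟨hb, by rw [← hbl]; exact hopen a ha⟩
  · intro x hx
    refine ⟨ψ⁻¹ x, ?_, ψ.apply_symm_apply x⟩
    rw [hp.mem_fundamentalAlcove_iff hΦ] at hx ⊢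
    intro a ha
    obtain ⟨b, hb, hbl, -⟩ := (hψ.inv hL).exists_level_comp hΦ hL ha.1
    rw [hbl]
    refine hx b ⟨hb, ?_⟩
    by_contra hneg
    have hbp : level b p < 0 := lt_of_le_of_ne (not_lt.mp hneg) (hp.level_ne_zero hΦ hb)
    have h1 := hopen (-b) ⟨hΦ.neg_mem hb, by rw [level_neg]; linarith⟩
    have h2 : level a (ψ⁻¹ (ψ p)) = level b (ψ p) := hbl _
    have h3 : ψ⁻¹ (ψ p) = p := ψ.symm_apply_apply p
    rw [h3] at h2
    rw [level_neg, ← h2] at h1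
    linarith [ha.2]

/-- Translate `p` by `l`, then bring it back into `C` by `W⁺`; normality moves the correction to the
other side of `t_l`. -/
theorem IsBasePoint.exists_isAlcoveTransformation [FiniteDimensional ℝ E] {Φ : Set E}
    (hΦ : IsRootSystem Φ) {ξ p : E} (hp : IsBasePoint Φ ξ p) {L : AddSubgroup E}
    [DiscreteTopology L] (hL : IsSubweight Φ L) {l : E} (hl : l ∈ L) :
    ∃ ψ, IsAlcoveTransformation Φ ξ l ψ := by
  obtain ⟨ρ, hρ, hmem⟩ := hp.exists_apply_mem hΦ hL (translation l p)
  refine ⟨ρ * translation l, ?_, hp.image_fundamentalAlcove hΦ hL ?_ hmem⟩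
  · rw [← mul_assoc]
    exact hL.conj_translation_mem hΦ hl hρ
  · exact ((hΦ.mem_affineWeylGroup_iff.mp hρ).mono hL.rootLattice_le).mul hL
      (isExtended_translation hl)

theorem IsBasePoint.isAlcoveTransformation_unique [FiniteDimensional ℝ E] {Φ : Set E}
    (hΦ : IsRootSystem Φ) {ξ p : E} (hp : IsBasePoint Φ ξ p) {L : AddSubgroup E}
    [DiscreteTopology L] (hL : IsSubweight Φ L) {l : E} {φ ψ : E ≃ᵃⁱ[ℝ] E}
    (hφ : IsAlcoveTransformation Φ ξ l φ) (hψ : IsAlcoveTransformation Φ ξ l ψ) : φ = ψ := by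
  have hmem : ψ⁻¹ * φ ∈ affineWeylGroup Φ := by
    have := mul_mem (inv_mem hψ.1) hφ.1
    simpa [mul_assoc] using this
  have hC : (ψ⁻¹ * φ) p ∈ fundamentalAlcove Φ ξ := by
    have h1 : φ p ∈ ψ '' fundamentalAlcove Φ ξ := by
      rw [hψ.2, ← hφ.2]
      exact ⟨p, hp.mem_fundamentalAlcove hΦ, rfl⟩
    obtain ⟨y, hy, hyp⟩ := h1
    have : (ψ⁻¹ * φ) p = y := by
      change ψ.symm (φ p) = y
      rw [← hyp, ψ.symm_apply_apply]
    rwa [this]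
  exact (inv_mul_eq_one.mp (hp.eq_one_of_mem_openAlcove hΦ hL hmem
    (hp.apply_mem_openAlcove hΦ hΦ.isSubweight_rootLattice
      (hΦ.mem_affineWeylGroup_iff.mp hmem) hC))).symm

theorem translation_mem {Φ : Set E} {l : E} (hl : l ∈ rootLattice Φ) :
    translation l ∈ affineWeylGroup Φ :=
  Subgroup.subset_closure (Or.inr ⟨l, hl, rfl⟩)

/-- This lets the transformation be indexed by classes modulo `Λ_a`. -/
theorem IsAlcoveTransformation.congr {Φ : Set E} {ξ l m : E} {ψ : E ≃ᵃⁱ[ℝ] E}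
    (h : IsAlcoveTransformation Φ ξ l ψ) (hlm : -m + l ∈ rootLattice Φ) :
    IsAlcoveTransformation Φ ξ m ψ := by
  refine ⟨?_, h.2⟩
  have := mul_mem (translation_mem hlm) h.1
  rw [← translation_mul, ← translation_inv] at this
  simpa [mul_assoc] using this

/-! ### The quotient of congruential subgroups -/

theorem sub_mem_rootSpacePart {Φ : Set E} {L : AddSubgroup E} {w : E ≃ₗᵢ[ℝ] E}
    (hw : w ∈ weylGroup Φ) {v : E} (h : w v - v ∈ L) : w v - v ∈ rootSpacePart Φ L :=
  ⟨h, Submodule.span_mono AddSubgroup.subset_closure (weylGroup_apply_sub_mem_span hw v)⟩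

/-- The homomorphism `w ↦ w v - v + Λ_a` from `W^{v+L}` to `L_0 / Λ_a`. -/
noncomputable def displacementHom {Φ : Set E} {L : AddSubgroup E} (hL : IsSubweight Φ L) (v : E) :
    congruentialSubgroup Φ L hL v →* Multiplicative (RootQuotient Φ L) :=
  MonoidHom.mk' (fun w => Multiplicative.ofAdd
    (QuotientAddGroup.mk (⟨w.1 v - v, sub_mem_rootSpacePart w.2.1 w.2.2⟩ : rootSpacePart Φ L)))
    fun a b => by
      rw [← ofAdd_add, ← QuotientAddGroup.mk_add]
      refine congrArg Multiplicative.ofAdd (QuotientAddGroup.eq.mpr ?_)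
      rw [AddSubgroup.mem_addSubgroupOf]
      -- The defect from additivity is `a` acting on `b v - v`, minus `b v - v` itself, up to sign.
      have := neg_mem (hL.apply_sub_mem_rootLattice a.2.1 _ b.2.2)
      convert this using 1
      change -(a.1 (b.1 v) - v) + ((a.1 v - v) + (b.1 v - v)) = _
      rw [map_sub]
      abel

theorem mk_rootSpacePart_eq_iff {Φ : Set E} {L : AddSubgroup E} {x y : rootSpacePart Φ L} :
    (x : RootQuotient Φ L) = y ↔ -(x : E) + y ∈ rootLattice Φ := by
  rw [QuotientAddGroup.eq, AddSubgroup.mem_addSubgroupOf]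
  rfl

theorem ker_displacementHom {Φ : Set E} (hΦ : IsRootSystem Φ) {L : AddSubgroup E}
    (hL : IsSubweight Φ L) (v : E) :
    (congruentialSubgroup Φ (rootLattice Φ) hΦ.isSubweight_rootLattice v).subgroupOf
      (congruentialSubgroup Φ L hL v) = (displacementHom hL v).ker := by
  ext w
  rw [Subgroup.mem_subgroupOf, MonoidHom.mem_ker]
  change (_ ∧ w.1 v - v ∈ rootLattice Φ) ↔
    QuotientAddGroup.mk (⟨w.1 v - v, sub_mem_rootSpacePart w.2.1 w.2.2⟩ : rootSpacePart Φ L) =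
      (0 : RootQuotient Φ L)
  rw [QuotientAddGroup.eq_zero_iff, AddSubgroup.mem_addSubgroupOf]
  exact and_iff_right w.2.1

theorem mem_range_displacementHom_iff {Φ : Set E} (hΦ : IsRootSystem Φ) {L : AddSubgroup E}
    (hL : IsSubweight Φ L) (v : E) (l : rootSpacePart Φ L) :
    Multiplicative.ofAdd (l : RootQuotient Φ L) ∈ (displacementHom hL v).range ↔
      ∃ ρ ∈ affineWeylGroup Φ, ρ v = translation (l : E) v := by
  constructor
  · rintro ⟨w, hw⟩
    have hw' := mk_rootSpacePart_eq_iff.mp (Multiplicative.ofAdd.injective hw)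
    refine ⟨translation (-(w.1 v - v) + l) * w.1.toAffineIsometryEquiv,
      mul_mem (translation_mem hw') (Subgroup.subset_closure (Or.inl ⟨w.1, w.2.1, rfl⟩)), ?_⟩
    change -(w.1 v - v) + (l : E) + w.1 v = l + v
    abel
  · rintro ⟨ρ, hρ, hv⟩
    obtain ⟨w, hw, m, hm, hρ⟩ := hΦ.mem_affineWeylGroup_iff.mp hρ
    rw [hρ, translation_apply] at hv
    have hwv : w v - v = l - m := by
      rw [sub_eq_sub_iff_add_eq_add, hv]
    have hmem : w v - v ∈ L := by
      rw [hwv]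
      exact sub_mem l.2.1 (hL.rootLattice_le hm)
    refine ⟨⟨w, hw, hmem⟩, congrArg Multiplicative.ofAdd (mk_rootSpacePart_eq_iff.mpr ?_)⟩
    change -(w v - v) + (l : E) ∈ rootLattice Φ
    rw [hwv]
    simpa using hm

/-- An alcove transformation in the class of `l` fixes the normalized point of `v` if and only if
`v` and its translate by `l` are in the same orbit of the affine Weyl group. -/
theorem IsBasePoint.alcoveTransformation_fix_iff [FiniteDimensional ℝ E] {Φ : Set E}
    (hΦ : IsRootSystem Φ) {ξ p : E} (hp : IsBasePoint Φ ξ p) {L : AddSubgroup E}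
    [DiscreteTopology L] (hL : IsSubweight Φ L) {l v y : E} (hl : l ∈ L) {ψ : E ≃ᵃⁱ[ℝ] E}
    (hψ : IsAlcoveTransformation Φ ξ l ψ) (hy : IsNormalizedPoint Φ ξ v y) :
    ψ y = y ↔ ∃ ρ ∈ affineWeylGroup Φ, ρ v = translation l v := by
  obtain ⟨hyC, σ, hσ, rfl⟩ := hy
  -- Chosen so that `ψ * σ = τ * translation l` with `τ` in `W⁺`: thus `ψ (σ v)` is in the orbit of
  -- `l + v`.
  set τ := translation l * ((translation l)⁻¹ * ψ * σ) * (translation l)⁻¹ with hτdef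
  have hτ : τ ∈ affineWeylGroup Φ := by
    have := hL.conj_translation_mem hΦ (neg_mem hl) (mul_mem hψ.1 hσ)
    rwa [← translation_inv, inv_inv] at this
  have hτv : τ (translation l v) = ψ (σ v) := by
    have : τ * translation l = ψ * σ := by
      rw [hτdef]
      group
    exact DFunLike.congr_fun this v
  constructor
  · intro h
    refine ⟨τ⁻¹ * σ, mul_mem (inv_mem hτ) hσ, ?_⟩
    change τ.symm (σ v) = _
    rw [← h, ← hτv, τ.symm_apply_apply]
  · rintro ⟨ρ, hρ, hv⟩
    have h1 : (τ * ρ * σ⁻¹) (σ v) = ψ (σ v) := by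
      rw [← hτv, ← hv]
      change τ (ρ (σ.symm (σ v))) = _
      rw [σ.symm_apply_apply]
    rw [← h1]
    refine hp.apply_eq_self hΦ hL (mul_mem (mul_mem hτ hρ) (inv_mem hσ)) hyC ?_
    rw [h1, ← hψ.2]
    exact ⟨_, hyC, rfl⟩

end WeylCongruence

open WeylCongruence in
theorem theorem2p5 {E : Type*} [NormedAddCommGroup E] [InnerProductSpace ℝ E]
    [FiniteDimensional ℝ E]
    (Φ : Set E) (hΦ : IsRootSystem Φ)
    (Λ : AddSubgroup E) [DiscreteTopology Λ] (hΛ : IsSubweight Φ Λ)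
    (ξ : E) (hξ : IsRegular Φ ξ) (v : E) :
    congruentialSubgroup Φ (rootLattice Φ) hΦ.isSubweight_rootLattice v ≤
        congruentialSubgroup Φ Λ hΛ v ∧
      ∃ _ : ((congruentialSubgroup Φ (rootLattice Φ) hΦ.isSubweight_rootLattice v).subgroupOf
          (congruentialSubgroup Φ Λ hΛ v)).Normal,
      ∃ (vbar : E) (ψ : RootQuotient Φ Λ → (E ≃ᵃⁱ[ℝ] E)) (Γ : AddSubgroup (RootQuotient Φ Λ)),
        -- the normalized point is the unique point of the orbit in the fundamental chamber
        (∀ y : E, IsNormalizedPoint Φ ξ v y ↔ y = vbar) ∧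
        -- the transformation of the chamber that corresponds to a class is well defined
        (∀ (l : rootSpacePart Φ Λ) (φ : E ≃ᵃⁱ[ℝ] E),
          IsAlcoveTransformation Φ ξ (l : E) φ ↔ φ = ψ (l : RootQuotient Φ Λ)) ∧
        (∀ q : RootQuotient Φ Λ, q ∈ Γ ↔ ψ q vbar = vbar) ∧
        Nonempty
          ((congruentialSubgroup Φ Λ hΛ v ⧸
              (congruentialSubgroup Φ (rootLattice Φ) hΦ.isSubweight_rootLattice v).subgroupOf
                (congruentialSubgroup Φ Λ hΛ v)) ≃*
            Multiplicative Γ) := by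
  obtain ⟨p, hp⟩ := exists_isBasePoint hΦ hξ
  have hker := ker_displacementHom hΦ hΛ v
  have hnormal : ((congruentialSubgroup Φ (rootLattice Φ) hΦ.isSubweight_rootLattice v).subgroupOf
      (congruentialSubgroup Φ Λ hΛ v)).Normal := by
    rw [hker]
    infer_instance
  obtain ⟨σ, hσ, hσC⟩ := hp.exists_apply_mem hΦ hΛ v
  have hvbar : IsNormalizedPoint Φ ξ v (σ v) := ⟨hσC, σ, hσ, rfl⟩
  choose f hf using fun l : rootSpacePart Φ Λ =>
    hp.exists_isAlcoveTransformation hΦ hΛ (l := (l : E)) l.2.1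
  have hψ : ∀ (l : rootSpacePart Φ Λ),
      IsAlcoveTransformation Φ ξ (l : E) (f (Quotient.out (l : RootQuotient Φ Λ))) := by
    intro l
    refine (hf _).congr (mk_rootSpacePart_eq_iff.mp ?_)
    exact (QuotientAddGroup.out_eq' _).symm
  -- Taking `Γ` to be the range makes the subgroup property and the isomorphism immediate; the
  -- fixed-point description is what remains.
  refine ⟨fun w hw => ⟨hw.1, hΛ.rootLattice_le hw.2⟩, hnormal, σ v,
    fun q => f (Quotient.out q), Subgroup.toAddSubgroup' (displacementHom hΛ v).range,
    ?_, ?_, ?_, ⟨(QuotientGroup.quotientMulEquivOfEq hker).trans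
      (QuotientGroup.quotientKerEquivRange (displacementHom hΛ v))⟩⟩
  · refine fun y => ⟨?_, ?_⟩
    · rintro ⟨hy, ρ, hρ, rfl⟩
      have h1 : (ρ * σ⁻¹) (σ v) = ρ v := by
        change ρ (σ.symm (σ v)) = _
        rw [σ.symm_apply_apply]
      rw [← h1] at hy ⊢
      exact hp.apply_eq_self hΦ hΛ (mul_mem hρ (inv_mem hσ)) hσC hy
    · rintro rfl
      exact hvbar
  · refine fun l φ => ⟨fun h => hp.isAlcoveTransformation_unique hΦ hΛ h (hψ l), ?_⟩
    rintro rfl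
    exact hψ l
  · intro q
    induction q using QuotientAddGroup.induction_on with
    | H l =>
      rw [hp.alcoveTransformation_fix_iff hΦ hΛ l.2.1 (hψ l) hvbar]
      exact mem_range_displacementHom_iff hΦ hΛ v l
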